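/- **Setting.** A network model with $L$ nodes, $K$ external excitation signals $r$ and white noise $e$ of dimension $p$ is a quadruple $(G,R,H,\Lambda)$ describing $w = Gw + Rr + He$, where: $G\in\mathbb R(z)^{L\times L}$ has zero diagonal and strictly proper stable entries; $R\in\mathbb R(z)^{L\times K}$ is proper with at most one nonzero entry in each row; $H\in\mathbb R(z)^{L\times p}$ is proper and stable, has a stable left inverse, and has a $p\times p$ submatrix that equals $I$ at $z=\infty$; the covariance $\Lambda\in\mathbb R^{p\times p}$ of $e$ is positive definite; and $(I-G)^{-1}$ exists and is proper and stable. A network model set is a family $M(\theta)=(G(\theta),R,H(\theta),\Lambda(\theta))$, $\theta\in\Theta$, of such models, with $\Theta\subseteq\mathbb R^{n}$ a Borel set and $R$ fixed; each entry of $[G(\theta)\ H(\theta)]$ is a quotient of polynomials in $z$ whose coefficients are Borel functions of $\theta\in\Theta$. An entry of $[G\ H]$ is *parametrized* if it is not constant on $\Theta$, and *fixed* otherwise. A parametrized entry is assumed to vary genuinely: for each $c\in\mathbb R(z)$ the set of $\theta\in\Theta$ at which it equals $c$ has Lebesgue measure zero. Let $T(\theta)=(I-G(\theta))^{-1}[H(\theta)\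 R]$. The model set is *generically identifiable from $(r,w)$* if for Lebesgue-almost all $\theta_0\in\Theta$ and all $\theta_1\in\Theta$, $T(\theta_0)=T(\theta_1)$ implies $G(\theta_0)=G(\theta_1)$ and $H(\theta_0)=H(\theta_1)$, and moreover $\Lambda(\theta_0)=\Lambda(\theta_1)$ if also the noise spectra $\omega \mapsto T_e\Lambda T_e^{*}$ at $z=\mathrm e^{\mathrm i\omega}$, $T_e=(I-G)^{-1}H$, coincide for $\theta_0$ and $\theta_1$. The *extended graph* has the vertices $w_1,\dots,w_L,e_1,\dots,e_p$, an edge $w_i\to w_j$ whenever $G_{ji}$ is not identically zero on $\Theta$, and an edge $e_k\to w_j$ whenever $H_{jk}$ is not identically zero on $\Theta$. Let $\mathcal E$ be its edge set; an edge is parametrized if the corresponding entry is. A *root* of a directed graph is a vertex from which every vertex is reachable by a directed path. A *SIMUG* (single-source identifiable multi-rooted graph) is a subgraph of the extended graph with at least two vertices and at least one root, in which each vertex has at most one incoming parametrized edge. Two SIMUGs are *edge-disjoint* if they have no common edge and, for each vertex, all its outgoing edges in their union belong to one of the two. A finite family of pairwise edge-disjoint SIMUGs $\mathcal T_1,\dots,\mathcal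 T_m$ is an *edge-disjoint SIMUG covering of $\mathcal E$* if the union of their edge sets is $\mathcal E$. **Theorem.** Let a network model set satisfy: 1. the parametrized entries of $[G\ H]$ are parametrized independently, i.e. different entries depend on disjoint groups of components of $\theta$; 2. every submatrix of $[G(\theta)-I\ \ H(\theta)\ \ R]$ that does not depend on $\theta$ has rank equal to its structural rank (the maximal rank of the matrices with the same nonzero pattern). Suppose there are an edge-disjoint SIMUG covering $\mathcal T_1,\dots,\mathcal T_m$ of $\mathcal E$, roots $\tau_k$ of $\mathcal T_k$, and pairwise distinct external signals $\sigma_1,\dots,\sigma_m\in\{e_1,\dots,e_p,r_1,\dots,r_K\}$ such that $\sigma_k$ excites $\tau_k$ for each $k$. (Here $e_k$ excites the vertex $e_k$ and every $w_j$ with $H_{jk}$ not identically zero, and $r_k$ excites every $w_j$ with $R_{jk}\neq 0$.) Then the model set is generically identifiable from $(r,w)$. -/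

import Mathlib

open MeasureTheory

noncomputable section

namespace DynNet

/-! ### Rational transfer functions in the shift variable `z` -/

/-- A rational transfer function is proper if the degree of its numerator does not exceed that of
its denominator. -/
def Proper (f : RatFunc ℝ) : Prop := f.num.degree ≤ f.denom.degree

/-- Strictly proper: the value at `z = ∞` is zero (the zero function is strictly proper). -/
def StrictlyProper (f : RatFunc ℝ) : Prop := f.num.degree < f.denom.degree

/-- Stable (discrete time): all complex poles lie in the open unit disk. -/
def Stable (f : RatFunc ℝ) : Prop :=
  ∀ z : ℂ, Polynomial.aeval z f.denom = 0 → ‖z‖ < 1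

/-! ### Network models and model sets -/

/-- `(G, R, H, Λ)` is a network model with `L` nodes, `K` external excitation signals and a noise
process of rank `p`. In each row of `R` there is at most one nonzero entry. -/
structure IsNetworkModel {L K p : ℕ} (G : Matrix (Fin L) (Fin L) (RatFunc ℝ))
    (R : Matrix (Fin L) (Fin K) (RatFunc ℝ)) (H : Matrix (Fin L) (Fin p) (RatFunc ℝ))
    (Λ : Matrix (Fin p) (Fin p) ℝ) : Prop where
  G_diag : ∀ j, G j j = 0
  G_strictlyProper : ∀ j i, StrictlyProper (G j i)
  G_stable : ∀ j i, Stable (G j i)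
  R_proper : ∀ j k, Proper (R j k)
  R_row : ∀ j k k', R j k ≠ 0 → R j k' ≠ 0 → k = k'
  H_proper : ∀ j k, Proper (H j k)
  H_stable : ∀ j k, Stable (H j k)
  H_leftInv : ∃ N : Matrix (Fin p) (Fin L) (RatFunc ℝ), (∀ k j, Stable (N k j)) ∧ N * H = 1
  H_monic : ∃ row : Fin p ↪ Fin L, ∀ i k,
    StrictlyProper (H (row i) k - (1 : Matrix (Fin p) (Fin p) (RatFunc ℝ)) i k)
  Λ_posDef : Λ.PosDef
  wellPosed_unit : IsUnit (1 - G).det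
  wellPosed_proper : ∀ j i, Proper ((1 - G)⁻¹ j i)
  wellPosed_stable : ∀ j i, Stable ((1 - G)⁻¹ j i)

/-- A network model set `{(G(θ), R, H(θ), Λ(θ)) ; θ ∈ Θ}`, `Θ ⊆ ℝⁿ`, with known (fixed) `R`. The
values of `G`, `H`, `Λ` outside `Θ` are irrelevant. -/
structure ModelSet (L K p n : ℕ) where
  Θ : Set (Fin n → ℝ)
  G : (Fin n → ℝ) → Matrix (Fin L) (Fin L) (RatFunc ℝ)
  R : Matrix (Fin L) (Fin K) (RatFunc ℝ)
  H : (Fin n → ℝ) → Matrix (Fin L) (Fin p) (RatFunc ℝ)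
  Λ : (Fin n → ℝ) → Matrix (Fin p) (Fin p) ℝ
  isModel : ∀ θ ∈ Θ, IsNetworkModel (G θ) R (H θ) (Λ θ)

/-- The vertices of the extended graph: `Sum.inl i` is the node `w_i`, `Sum.inr k` is the white
noise source `e_k`. -/
abbrev Vertex (L p : ℕ) : Type := Fin L ⊕ Fin p

/-- The external signals: `Sum.inl k` is `e_k`, `Sum.inr k` is `r_k`. -/
abbrev Signal (p K : ℕ) : Type := Fin p ⊕ Fin K

namespace ModelSet

variable {L K p n : ℕ} (M : ModelSet L K p n)

/-- The entry of `[G(θ) H(θ)]` in row `j` and in the column of the vertex `v`. -/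
def entry (θ : Fin n → ℝ) (j : Fin L) : Vertex L p → RatFunc ℝ :=
  Sum.elim (M.G θ j) (M.H θ j)

/-- The entry of `[G H]` at `(j, v)` is parametrized: it depends on `θ ∈ Θ`. -/
def Parametrized (j : Fin L) (v : Vertex L p) : Prop :=
  ∃ θ ∈ M.Θ, ∃ θ' ∈ M.Θ, M.entry θ j v ≠ M.entry θ' j v

/-- The edges of the extended graph: there is an edge from `v` to the node `w_j` if the
corresponding entry of `[G H]` is not identically zero on `Θ`; there is no edge into a noise
source. -/
def Edge (v : Vertex L p) : Vertex L p → Prop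
  | Sum.inl j => ∃ θ ∈ M.Θ, M.entry θ j v ≠ 0
  | Sum.inr _ => False

/-- The parametrized edges of the extended graph. -/
def ParamEdge (v : Vertex L p) : Vertex L p → Prop
  | Sum.inl j => M.Parametrized j v
  | Sum.inr _ => False

/-- `T(θ) = (I - G(θ))⁻¹ [H(θ) R]`. -/
def T (θ : Fin n → ℝ) : Matrix (Fin L) (Signal p K) (RatFunc ℝ) :=
  (1 - M.G θ)⁻¹ * Matrix.fromCols (M.H θ) M.R

/-- The frequency response at `z = exp(i ω)` of the transfer matrix `(I - G)⁻¹ H` from the white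
noise to the nodes. -/
def noiseResponse (θ : Fin n → ℝ) (ω : ℝ) : Matrix (Fin L) (Fin p) ℂ :=
  ((1 - M.G θ)⁻¹ * M.H θ).map
    (RatFunc.eval (algebraMap ℝ ℂ) (Complex.exp (Complex.I * (ω : ℂ))))

/-- The spectral density at frequency `ω` of the contribution `(I - G)⁻¹ H e` of the noise to the
node signals, where the white noise `e` has covariance `Λ`. -/
def noiseSpectrum (θ : Fin n → ℝ) (ω : ℝ) : Matrix (Fin L) (Fin L) ℂ :=
  M.noiseResponse θ ω * (M.Λ θ).map (algebraMap ℝ ℂ) * (M.noiseResponse θ ω).conjTranspose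

/-- Generic identifiability from `(r, w)`: for almost all `θ₀ ∈ Θ`, every model of the set with the
same `T` as `M(θ₀)` coincides with `M(θ₀)`. As `T` carries no information on the noise covariance,
`Λ` is compared for models whose noise spectra agree as well. -/
def GenericallyIdentifiable : Prop :=
  ∀ᵐ θ₀ : Fin n → ℝ, θ₀ ∈ M.Θ → ∀ θ₁ ∈ M.Θ, M.T θ₀ = M.T θ₁ →
    M.G θ₀ = M.G θ₁ ∧ M.H θ₀ = M.H θ₁ ∧
      (M.noiseSpectrum θ₀ = M.noiseSpectrum θ₁ → M.Λ θ₀ = M.Λ θ₁)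

/-! ### Assumptions on the parametrization -/

/-- `Θ` is a Borel set, and every entry of `[G(θ) H(θ)]` is on `Θ` a quotient of two polynomials in
`z` whose coefficients are Borel functions of `θ`. -/
structure MeasurablyParametrized : Prop where
  measurableSet : MeasurableSet M.Θ
  entry_eq : ∀ j v, ∃ N D : (Fin n → ℝ) → Polynomial ℝ,
    (∀ k, Measurable fun θ => (N θ).coeff k) ∧ (∀ k, Measurable fun θ => (D θ).coeff k) ∧
    ∀ θ ∈ M.Θ, D θ ≠ 0 ∧
      M.entry θ j v = algebraMap (Polynomial ℝ) (RatFunc ℝ) (N θ) /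
        algebraMap (Polynomial ℝ) (RatFunc ℝ) (D θ)

/-- A parametrized entry does not stick to a fixed transfer function: it takes each given value
only on a Lebesgue null set of parameters. -/
def GenuinelyParametrized : Prop :=
  ∀ j v, M.Parametrized j v → ∀ c : RatFunc ℝ, volume {θ ∈ M.Θ | M.entry θ j v = c} = 0

/-- The entries of `[G H]` are parametrized independently: different entries depend on disjoint
groups of parameters. -/
def IndependentlyParametrized : Prop :=
  ∃ block : Fin L → Vertex L p → Set (Fin n),
    (∀ j v j' v', (j, v) ≠ (j', v') → Disjoint (block j v) (block j' v')) ∧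
    ∀ j v, ∀ θ ∈ M.Θ, ∀ θ' ∈ M.Θ, (∀ l ∈ block j v, θ l = θ' l) →
      M.entry θ j v = M.entry θ' j v

end ModelSet

/-- The structural rank of a matrix: the maximal rank of the matrices with the same nonzero
pattern. -/
def structuralRank {F m n : Type*} [Field F] [Fintype n] (A : Matrix m n F) : ℕ :=
  sSup {k | ∃ B : Matrix m n F, (∀ i j, B i j ≠ 0 ↔ A i j ≠ 0) ∧ B.rank = k}

namespace ModelSet

variable {L K p n : ℕ} (M : ModelSet L K p n)

/-- The matrix `[G(θ) - I  H(θ)  R]`. -/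
def fullMatrix (θ : Fin n → ℝ) : Matrix (Fin L) (Fin L ⊕ Signal p K) (RatFunc ℝ) :=
  Matrix.fromCols (M.G θ - 1) (Matrix.fromCols (M.H θ) M.R)

/-- The rank of every submatrix of `[G - I  H  R]` that does not depend on `θ` is equal to its
structural rank. -/
def FixedFullStructuralRank : Prop :=
  ∀ (rows : Finset (Fin L)) (cols : Finset (Fin L ⊕ Signal p K)),
    (∀ i ∈ rows, ∀ j ∈ cols, ∀ θ ∈ M.Θ, ∀ θ' ∈ M.Θ,
      M.fullMatrix θ i j = M.fullMatrix θ' i j) →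
    ∀ θ ∈ M.Θ,
      ((M.fullMatrix θ).submatrix (fun i : rows => i.1) (fun j : cols => j.1)).rank =
        structuralRank ((M.fullMatrix θ).submatrix (fun i : rows => i.1) (fun j : cols => j.1))

end ModelSet

/-! ### Multi-rooted graphs -/

/-- A directed graph on a set of vertices taken from `V`. -/
structure SubDigraph (V : Type*) where
  verts : Set V
  Adj : V → V → Prop
  left_mem : ∀ {i j}, Adj i j → i ∈ verts
  right_mem : ∀ {i j}, Adj i j → j ∈ verts

namespace SubDigraph

variable {V : Type*} (S : SubDigraph V)

/-- The roots: the vertices from which there is a directed path to every vertex. -/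
def roots : Set V := {v ∈ S.verts | ∀ u ∈ S.verts, Relation.ReflTransGen S.Adj v u}

/-- A multi-rooted graph has at least two vertices and at least one root (so it is connected). -/
def IsMultiRooted : Prop := 2 ≤ S.verts.encard ∧ S.roots.Nonempty

/-- Two graphs have no common edges, and for each vertex all its outgoing edges in the union belong
to one of the two. -/
def EdgeDisjoint (S S' : SubDigraph V) : Prop :=
  (∀ i j, ¬ (S.Adj i j ∧ S'.Adj i j)) ∧
  ∀ i ∈ S.verts ∪ S'.verts,
    (∀ j, S.Adj i j ∨ S'.Adj i j → S.Adj i j) ∨ (∀ j, S.Adj i j ∨ S'.Adj i j → S'.Adj i j)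

end SubDigraph

namespace ModelSet

variable {L K p n : ℕ} (M : ModelSet L K p n)

/-- A single-source identifiable multi-rooted graph: a multi-rooted subgraph of the extended graph
in which every vertex has at most one incoming parametrized edge. -/
def IsSIMUG (S : SubDigraph (Vertex L p)) : Prop :=
  (∀ i j, S.Adj i j → M.Edge i j) ∧ S.IsMultiRooted ∧
    ∀ j ∈ S.verts, {i | S.Adj i j ∧ M.ParamEdge i j}.encard ≤ 1

/-- `S 0, …, S (m - 1)` is an edge-disjoint covering of the edges of the extended graph by
SIMUGs. -/
def IsEdgeDisjointSIMUGCovering {m : ℕ} (S : Fin m → SubDigraph (Vertex L p)) : Prop :=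
  (∀ k, M.IsSIMUG (S k)) ∧ (∀ k k', k ≠ k' → (S k).EdgeDisjoint (S k')) ∧
    ∀ i j, M.Edge i j ↔ ∃ k, (S k).Adj i j

/-- An external signal excites a vertex directly: `e_k` excites the vertex `e_k` itself and the
nodes `w_j` with `H_{jk} ≠ 0`; `r_k` excites the nodes `w_j` with `R_{jk} ≠ 0`. -/
def Excites : Signal p K → Vertex L p → Prop
  | Sum.inl k, Sum.inr i => i = k
  | Sum.inl k, Sum.inl j => M.Edge (Sum.inr k) (Sum.inl j)
  | Sum.inr _, Sum.inr _ => False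
  | Sum.inr k, Sum.inl j => M.R j k ≠ 0

end ModelSet

end DynNet

end

noncomputable section

namespace DynNet

/-! ### Null sets of parameters -/

/-! Write `A(θ) = [G - I H R]`. If two models have the same `T`, then `A(θ₀) - A(θ₁) = Y A(θ₀)` for
a square matrix `Y`. In row `j` the left side vanishes in every column where row `j` is fixed. So if
`L` columns avoiding the parametrized entries of row `j` form a nonsingular submatrix of `A(θ₀)`,
then row `j` of `Y` is zero and the two `j`-th rows agree (`fullMatrix_row_eq`). Two facts supply
such columns for almost all `θ₀`.

Combinatorics (`exists_matching`): the rows have a perfect matching into the allowed columns. By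
default row `i` uses its own column, where the entry is `-1`. That column is forbidden when `w_i` is
a parametrized in-neighbour of `w_j`. Different such in-neighbours lie in different SIMUGs, since
each SIMUG has at most one parametrized edge into `w_j`. For a set of rows containing `i`, a path to
`w_i` from the excited root of its SIMUG supplies a substitute column, either where the path enters
the set or from the external signal. Columns serving different SIMUGs are different, so Hall's
condition holds.

Genericity (`ae_det_submatrix_ne_zero`): a square submatrix with a perfect matching is nonsingular
almost everywhere. The induction expands the determinant along a row at a parametrized entry. If the
cofactor is nonzero and the determinant vanishes, that entry equals a quotient independent of its
own parameters; a Fubini argument makes this exceptional set null. Submatrices without parametrized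
entries are handled by the structural rank assumption.

Once `G` and `H` agree, the stable left inverse of `H` recovers `Λ` from the noise spectrum. -/

/-- A measurable subset of a product on which `g` is constant along the slices in both directions
is null if all the level sets of `g` in it are null. -/
theorem measure_prod_null_of_const_on_slices {X Y F : Type*} [MeasurableSpace X]
    [MeasurableSpace Y] {μ : Measure X} {ν : Measure Y} [SFinite ν] {E : Set (X × Y)}
    (hE : MeasurableSet E) (g : X × Y → F)
    (hfst : ∀ x x' y, (x, y) ∈ E → (x', y) ∈ E → g (x, y) = g (x', y))
    (hsnd : ∀ x y y', (x, y) ∈ E → (x, y') ∈ E → g (x, y) = g (x, y'))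
    (hg : ∀ a, μ.prod ν {q ∈ E | g q = a} = 0) : μ.prod ν E = 0 := by
  classical
  -- On `B` the slices have positive measure, and `c` records the single value of `g` on each.
  let B : Set X := {x | ν (Prod.mk x ⁻¹' E) ≠ 0}
  have hB : ∀ x : B, ∃ y, (x.1, y) ∈ E := fun x => nonempty_of_measure_ne_zero x.2
  choose u hu using hB
  let c : B → F := fun x => g (x.1, u x)
  have hc : ∀ a : Set.range c, ∃ x : B, c x = a.1 := fun a => a.2
  choose s hs using hc
  have hgs : ∀ (a : Set.range c) y, ((s a).1, y) ∈ E → g ((s a).1, y) = a.1 := fun a y hy =>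
    (hsnd _ _ _ hy (hu (s a))).trans (hs a)
  -- Slices over points with different values of `c` are disjoint, because `g` does not change when
  -- only `x` moves. An s-finite measure admits only countably many disjoint measurable sets of
  -- positive measure, so the null level sets can be discarded together although `F` may be
  -- uncountable.
  have hcount : (Set.range c).Countable := by
    have := Measure.countable_meas_pos_of_disjoint_iUnion (μ := ν)
      (As := fun a : Set.range c => Prod.mk (s a).1 ⁻¹' E)
      (fun a => measurable_prodMk_left hE) (fun a b hab => by
        refine Set.disjoint_left.2 fun y hy hy' => hab (Subtype.ext ?_)
        rw [← hgs a y hy, ← hgs b y hy']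
        exact hfst _ _ _ hy hy')
    have huniv : {a : Set.range c | 0 < ν (Prod.mk (s a).1 ⁻¹' E)} = Set.univ :=
      Set.eq_univ_of_forall fun a => pos_iff_ne_zero.2 (s a).2
    rw [huniv] at this
    exact Set.countable_coe_iff.1 (Set.countable_univ_iff.1 this)
  rw [Measure.measure_prod_null hE]
  have hae : ∀ᵐ x ∂μ, ∀ a ∈ Set.range c, ν (Prod.mk x ⁻¹' {q ∈ E | g q = a}) = 0 :=
    (ae_ball_iff hcount).2 fun a _ => Measure.measure_ae_null_of_prod_null (hg a)
  filter_upwards [hae] with x hx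
  by_contra hne
  refine hne (measure_mono_null ?_ (hx (c ⟨x, hne⟩) ⟨_, rfl⟩))
  exact fun y hy => ⟨hy, hsnd _ _ _ hy (hu ⟨x, hne⟩)⟩

/-- A measurable set of parameters on which `g` depends neither on the coordinates in `s` nor on
those outside `s` is null if all the level sets of `g` in it are null. -/
theorem volume_null_of_const_on_slices {n : ℕ} {F : Type*} {E : Set (Fin n → ℝ)}
    (hE : MeasurableSet E) (s : Set (Fin n)) (g : (Fin n → ℝ) → F)
    (hin : ∀ θ ∈ E, ∀ θ' ∈ E, (∀ l ∈ s, θ l = θ' l) → g θ = g θ')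
    (hout : ∀ θ ∈ E, ∀ θ' ∈ E, (∀ l ∉ s, θ l = θ' l) → g θ = g θ')
    (hg : ∀ a, volume {θ ∈ E | g θ = a} = 0) : volume E = 0 := by
  classical
  let e := MeasurableEquiv.piEquivPiSubtypeProd (fun _ : Fin n => ℝ) (· ∈ s)
  have he : MeasurePreserving e volume volume :=
    volume_preserving_piEquivPiSubtypeProd (fun _ : Fin n => ℝ) (· ∈ s)
  have hvol : ∀ A : Set (Fin n → ℝ), volume (e.symm ⁻¹' A) = volume A := fun A =>
    (he.symm e).measure_preimage_equiv A
  have hval : ∀ q l (h : l ∈ s), e.symm q l = q.1 ⟨l, h⟩ := fun q l h => by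
    conv_rhs => rw [← e.apply_symm_apply q]
    rfl
  have hval' : ∀ q l (h : l ∉ s), e.symm q l = q.2 ⟨l, h⟩ := fun q l h => by
    conv_rhs => rw [← e.apply_symm_apply q]
    rfl
  rw [← hvol]
  refine measure_prod_null_of_const_on_slices (e.symm.measurable hE) (g ∘ e.symm)
    (fun x x' y h h' => hout _ h _ h' fun l hl => ?_)
    (fun x y y' h h' => hin _ h _ h' fun l hl => ?_) fun a => ?_
  · rw [hval' _ _ hl, hval' _ _ hl]
  · rw [hval _ _ hl, hval _ _ hl]
  · exact (hvol {θ ∈ E | g θ = a}).trans (hg a)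

/-- The families of rational functions that are on `Θ` quotients of polynomials with measurable
coefficients. -/
def measurableFamilies {n : ℕ} (Θ : Set (Fin n → ℝ)) : Subring ((Fin n → ℝ) → RatFunc ℝ) where
  carrier := {f | ∃ N D : (Fin n → ℝ) → Polynomial ℝ,
    (∀ k, Measurable fun θ => (N θ).coeff k) ∧ (∀ k, Measurable fun θ => (D θ).coeff k) ∧
    ∀ θ ∈ Θ, D θ ≠ 0 ∧ f θ = algebraMap (Polynomial ℝ) (RatFunc ℝ) (N θ) /
      algebraMap (Polynomial ℝ) (RatFunc ℝ) (D θ)}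
  zero_mem' := ⟨0, 1, fun _ => by simp, fun k => by simp, fun θ _ => by simp⟩
  one_mem' := ⟨1, 1, fun k => by simp, fun k => by simp, fun θ _ => by simp⟩
  mul_mem' := by
    rintro f f' ⟨N, D, hN, hD, h⟩ ⟨N', D', hN', hD', h'⟩
    refine ⟨fun θ => N θ * N' θ, fun θ => D θ * D' θ, fun k => ?_, fun k => ?_, fun θ hθ =>
      ⟨mul_ne_zero (h θ hθ).1 (h' θ hθ).1, ?_⟩⟩
    · simp only [Polynomial.coeff_mul]
      exact Finset.measurable_fun_sum _ fun i _ => (hN _).mul (hN' _)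
    · simp only [Polynomial.coeff_mul]
      exact Finset.measurable_fun_sum _ fun i _ => (hD _).mul (hD' _)
    · rw [Pi.mul_apply, (h θ hθ).2, (h' θ hθ).2, map_mul, map_mul, div_mul_div_comm]
  add_mem' := by
    rintro f f' ⟨N, D, hN, hD, h⟩ ⟨N', D', hN', hD', h'⟩
    refine ⟨fun θ => N θ * D' θ + D θ * N' θ, fun θ => D θ * D' θ, fun k => ?_, fun k => ?_,
      fun θ hθ => ⟨mul_ne_zero (h θ hθ).1 (h' θ hθ).1, ?_⟩⟩
    · simp only [Polynomial.coeff_add, Polynomial.coeff_mul]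
      exact (Finset.measurable_fun_sum _ fun i _ => (hN _).mul (hD' _)).add
        (Finset.measurable_fun_sum _ fun i _ => (hD _).mul (hN' _))
    · simp only [Polynomial.coeff_mul]
      exact Finset.measurable_fun_sum _ fun i _ => (hD _).mul (hD' _)
    · rw [Pi.add_apply, (h θ hθ).2, (h' θ hθ).2, map_add, map_mul, map_mul, map_mul,
        div_add_div _ _ (RatFunc.algebraMap_ne_zero (h θ hθ).1)
          (RatFunc.algebraMap_ne_zero (h' θ hθ).1)]
  neg_mem' := by
    rintro f ⟨N, D, hN, hD, h⟩
    refine ⟨fun θ => -N θ, D, fun k => ?_, hD, fun θ hθ => ⟨(h θ hθ).1, ?_⟩⟩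
    · simp only [Polynomial.coeff_neg]
      exact (hN k).neg
    · rw [Pi.neg_apply, (h θ hθ).2, map_neg, neg_div]

theorem const_mem_measurableFamilies {n : ℕ} (Θ : Set (Fin n → ℝ)) (c : RatFunc ℝ) :
    (fun _ => c) ∈ measurableFamilies Θ :=
  ⟨fun _ => c.num, fun _ => c.denom, fun _ => measurable_const, fun _ => measurable_const,
    fun _ _ => ⟨c.denom_ne_zero, (RatFunc.num_div_denom c).symm⟩⟩

/-- The quotient vanishes exactly when all coefficients of the numerator do, which is a countable
family of Borel conditions. -/
theorem measurableSet_eq_zero_of_mem_measurableFamilies {n : ℕ} {Θ : Set (Fin n → ℝ)}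
    (hΘ : MeasurableSet Θ) {f : (Fin n → ℝ) → RatFunc ℝ} (hf : f ∈ measurableFamilies Θ) :
    MeasurableSet {θ ∈ Θ | f θ = 0} := by
  obtain ⟨N, D, hN, hD, h⟩ := hf
  have : {θ ∈ Θ | f θ = 0} = Θ ∩ ⋂ k, {θ | (N θ).coeff k = 0} := by
    ext θ
    simp only [Set.mem_ofPred_eq, Set.mem_inter_iff, Set.mem_iInter, and_congr_right_iff]
    intro hθ
    rw [(h θ hθ).2, div_eq_zero_iff, or_iff_left (RatFunc.algebraMap_ne_zero (h θ hθ).1),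
      FaithfulSMul.algebraMap_eq_zero_iff, Polynomial.ext_iff]
    rfl
  rw [this]
  exact hΘ.inter (MeasurableSet.iInter fun k => measurableSet_eq_fun (hN k) measurable_const)

theorem det_mem_measurableFamilies {n : ℕ} {Θ : Set (Fin n → ℝ)} {ι : Type*} [Fintype ι]
    [DecidableEq ι] {B : (Fin n → ℝ) → Matrix ι ι (RatFunc ℝ)}
    (hB : ∀ i j, (fun θ => B θ i j) ∈ measurableFamilies Θ) :
    (fun θ => (B θ).det) ∈ measurableFamilies Θ := by
  have : (fun θ => (B θ).det) = ∑ σ : Equiv.Perm ι,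
      (Equiv.Perm.sign σ : ℤ) • ∏ i, fun θ => B θ (σ i) i := by
    ext1 θ
    simp [Matrix.det_apply, Finset.sum_apply, Finset.prod_apply, Units.smul_def]
  rw [this]
  exact sum_mem fun σ _ => zsmul_mem (prod_mem fun i _ => hB _ _) _

/-! ### Structural rank -/

/-- Take `t • 1 - N` with `N` equal to `-1` at the off-diagonal nonzero positions; over an infinite
field some nonzero `t` is not an eigenvalue of `N`. -/
theorem exists_det_ne_zero_of_diag {F ι : Type*} [Field F] [Infinite F] [Fintype ι]
    [DecidableEq ι] (A : Matrix ι ι F) (hA : ∀ i, A i i ≠ 0) :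
    ∃ B : Matrix ι ι F, (∀ i j, B i j ≠ 0 ↔ A i j ≠ 0) ∧ B.det ≠ 0 := by
  classical
  let N : Matrix ι ι F := fun i j => if i ≠ j ∧ A i j ≠ 0 then -1 else 0
  obtain ⟨t, ht⟩ := Infinite.exists_notMem_finset (insert 0 N.charpoly.roots.toFinset)
  rw [Finset.mem_insert, not_or, Multiset.mem_toFinset,
    Polynomial.mem_roots N.charpoly_monic.ne_zero, Polynomial.IsRoot, Matrix.eval_charpoly] at ht
  refine ⟨_, fun i j => ?_, ht.2⟩
  rw [Matrix.sub_apply, Matrix.scalar_apply]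
  by_cases hij : i = j
  · subst hij
    simp [N, ht.1, hA]
  · simp [N, hij]

/-- A nonvanishing diagonal makes the structural rank full, so equality of ranks forces
invertibility. This turns the rank assumption into the base case of the genericity induction. -/
theorem det_ne_zero_of_rank_eq_structuralRank {F ι m n : Type*} [Field F] [Infinite F]
    [Fintype ι] [DecidableEq ι] [Fintype n] (A : Matrix m n F) (er : ι ≃ m) (ec : ι ≃ n)
    (hdiag : ∀ i, A (er i) (ec i) ≠ 0) (hA : A.rank = structuralRank A) :
    (A.submatrix er ec).det ≠ 0 := by
  obtain ⟨B, hB, hdet⟩ := exists_det_ne_zero_of_diag (A.submatrix er ec) hdiag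
  have hle : Fintype.card ι ≤ structuralRank A := by
    refine le_csSup ⟨Fintype.card n, ?_⟩ ⟨B.submatrix er.symm ec.symm, fun i j => ?_, ?_⟩
    · rintro _ ⟨C, -, rfl⟩
      exact C.rank_le_card_width
    · simpa using hB (er.symm i) (ec.symm j)
    · rw [Matrix.rank_submatrix, Matrix.rank_of_isUnit]
      exact (Matrix.isUnit_iff_isUnit_det _).2 hdet.isUnit
  rw [← hA, ← Matrix.rank_submatrix A er ec, Matrix.rank_eq_finrank_span_row] at hle
  exact ((Matrix.isUnit_iff_isUnit_det _).1 (Matrix.linearIndependent_rows_iff_isUnit.1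
    (linearIndependent_iff_card_le_finrank_span.2 hle))).ne_zero

/-! ### Generic nonsingularity of structurally nonsingular matrices -/

/-- Linearity in row `a`: the first determinant on the right is the cofactor of the entry `(a, b)`,
and neither determinant there involves that entry. -/
theorem det_eq_mul_add_of_row {ι F : Type*} [CommRing F] [Fintype ι] [DecidableEq ι]
    (B : Matrix ι ι F) (a b : ι) :
    B.det = B a b * (B.updateRow a (Pi.single b 1)).det +
      (B.updateRow a (Function.update (B a) b 0)).det := by
  rw [← Matrix.det_updateRow_smul, ← Matrix.det_updateRow_add]
  have : B a b • Pi.single b 1 + Function.update (B a) b 0 = B a := by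
    ext j
    by_cases h : j = b
    · subst h; simp
    · simp [h]
  rw [this, Matrix.updateRow_eq_self]

/-- Extending `f` by `a ↦ b` gives a permutation of the columns after which the matrix is block
triangular, with blocks the given minor and `1`. -/
theorem det_updateRow_single_ne_zero {ι F : Type*} [Field F] [Fintype ι] [DecidableEq ι]
    (B : Matrix ι ι F) (a b : ι) (f : {i // i ≠ a} → ι) (hf : Function.Injective f)
    (hfb : ∀ i, f i ≠ b) (hB : (B.submatrix Subtype.val f).det ≠ 0) :
    (B.updateRow a (Pi.single b 1)).det ≠ 0 := by
  let g : ι → ι := fun i => if h : i = a then b else f ⟨i, h⟩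
  have ga : g a = b := dif_pos rfl
  have gf : ∀ i : {i // i ≠ a}, g i = f i := fun i => dif_neg i.2
  have hg : Function.Injective g := by
    intro i i' h
    by_cases hi : i = a <;> by_cases hi' : i' = a
    · rw [hi, hi']
    · rw [hi, ga, gf ⟨i', hi'⟩] at h
      exact absurd h.symm (hfb _)
    · rw [hi', ga, gf ⟨i, hi⟩] at h
      exact absurd h (hfb _)
    · rw [gf ⟨i, hi⟩, gf ⟨i', hi'⟩] at h
      exact congrArg Subtype.val (hf h)
  let π : Equiv.Perm ι := Equiv.ofBijective g (Finite.injective_iff_bijective.1 hg)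
  have hrow : ∀ j, (B.updateRow a (Pi.single b 1)).submatrix id π a j = if j = a then 1 else 0 := by
    intro j
    have : π j = b ↔ j = a := by
      rw [← ga]
      exact hg.eq_iff
    simp [Pi.single_apply, this]
  intro h0
  have h1 : ((B.updateRow a (Pi.single b 1)).submatrix id π).det = 0 := by
    rw [Matrix.det_permute', h0, mul_zero]
  rw [Matrix.twoBlockTriangular_det _ (· ≠ a)
    (fun i hi j hj => by rw [not_not.1 hi, hrow, if_neg hj])] at h1
  have h2 : (((B.updateRow a (Pi.single b 1)).submatrix id π).toSquareBlockProp
      fun i => ¬ i ≠ a).det = 1 := by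
    have : Subsingleton {i : ι // ¬ i ≠ a} :=
      ⟨fun i j => Subtype.ext ((not_not.1 i.2).trans (not_not.1 j.2).symm)⟩
    rw [Matrix.det_eq_elem_of_subsingleton _ ⟨a, not_not.2 rfl⟩]
    exact (hrow a).trans (if_pos rfl)
  rw [h2, mul_one] at h1
  refine hB ?_
  convert h1 using 2
  ext i j
  simp [Matrix.toSquareBlockProp_def, Matrix.updateRow_ne i.2, π, gf]

/-- Either deleting the row `a` and the column `b` leaves a perfect matching, or some set of rows
has all its nonzero entries in the columns with the same indices and contains `b` but not `a`. -/
theorem exists_injective_or_exists_closed {ι : Type*} [Fintype ι] [DecidableEq ι]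
    (r : ι → ι → Prop) (hr : ∀ i, r i i) (a b : ι) :
    (∃ f : {i // i ≠ a} → ι, Function.Injective f ∧ ∀ i, f i ≠ b ∧ r i (f i)) ∨
      ∃ S : Finset ι, b ∈ S ∧ a ∉ S ∧ ∀ i ∈ S, ∀ j, r i j → j ∈ S := by
  classical
  by_cases h : ∃ S : Finset ι, b ∈ S ∧ a ∉ S ∧ ∀ i ∈ S, ∀ j, r i j → j ∈ S
  · exact Or.inr h
  left
  push Not at h
  let t : {i // i ≠ a} → Finset ι := fun i => {j | j ≠ b ∧ r i j}
  -- Hall's condition: each row of `s` other than `b` offers its own diagonal column. If `b` is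
  -- among the rows, one column is missing, and since the row set is not closed an entry leading out
  -- of it makes up the loss.
  have hall : ∀ s : Finset {i // i ≠ a}, s.card ≤ (s.biUnion t).card := by
    intro s
    let S : Finset ι := s.map (Function.Embedding.subtype _)
    have hcard : S.card = s.card := Finset.card_map _
    have haS : a ∉ S := by simp [S]
    have hsub : S.erase b ⊆ s.biUnion t := by
      intro i hi
      obtain ⟨hib, hi⟩ := Finset.mem_erase.1 hi
      obtain ⟨i', hi', rfl⟩ := Finset.mem_map.1 hi
      exact Finset.mem_biUnion.2 ⟨i', hi', by simpa [t] using ⟨hib, hr _⟩⟩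
    rw [← hcard]
    by_cases hb : b ∈ S
    · obtain ⟨i, hi, j, hij, hj⟩ := h S hb haS
      obtain ⟨i', hi', rfl⟩ := Finset.mem_map.1 hi
      have hjt : j ∈ s.biUnion t := by
        refine Finset.mem_biUnion.2 ⟨i', hi', ?_⟩
        simp only [t, Finset.mem_filter, Finset.mem_univ, true_and]
        exact ⟨fun hjb => hj (hjb ▸ hb), hij⟩
      calc S.card = (insert j (S.erase b)).card := by
            rw [Finset.card_insert_of_notMem (fun h => hj (Finset.mem_of_mem_erase h)),
              Finset.card_erase_add_one hb]
        _ ≤ _ := Finset.card_le_card (Finset.insert_subset hjt hsub)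
    · rw [Finset.erase_eq_of_notMem hb] at hsub
      exact Finset.card_le_card hsub
  obtain ⟨f, hf, hft⟩ := (Finset.all_card_le_biUnion_card_iff_exists_injective t).1 hall
  exact ⟨f, hf, fun i => by simpa [t] using hft i⟩

/-- Consider a matrix whose entries are measurable in the parameters, depend on disjoint groups of
them, and, unless fixed, take each value only on a null set; let the fixed submatrices that have a
perfect matching be nonsingular. Then each square submatrix that has a perfect matching is
nonsingular for almost all parameters. -/
theorem ae_det_submatrix_ne_zero {n : ℕ} {Θ : Set (Fin n → ℝ)} (hΘ : MeasurableSet Θ)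
    {I J : Type} (A : (Fin n → ℝ) → Matrix I J (RatFunc ℝ))
    (hA : ∀ i j, (fun θ => A θ i j) ∈ measurableFamilies Θ)
    (hgen : ∀ i j, (∃ θ ∈ Θ, ∃ θ' ∈ Θ, A θ i j ≠ A θ' i j) →
      ∀ c, volume {θ ∈ Θ | A θ i j = c} = 0)
    (block : I → J → Set (Fin n))
    (hdisj : ∀ i j i' j', (i, j) ≠ (i', j') → Disjoint (block i j) (block i' j'))
    (hblock : ∀ i j, ∀ θ ∈ Θ, ∀ θ' ∈ Θ, (∀ l ∈ block i j, θ l = θ' l) → A θ i j = A θ' i j)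
    (hfix : ∀ {ι : Type} [Fintype ι] [DecidableEq ι] (r : ι → I) (c : ι → J),
      Function.Injective r → Function.Injective c →
      (∀ i j, ∀ θ ∈ Θ, ∀ θ' ∈ Θ, A θ (r i) (c j) = A θ' (r i) (c j)) →
      ∀ θ ∈ Θ, (∀ i, A θ (r i) (c i) ≠ 0) → ((A θ).submatrix r c).det ≠ 0)
    {ι : Type} [Fintype ι] [DecidableEq ι] (r : ι → I) (c : ι → J)
    (hr : Function.Injective r) (hc : Function.Injective c)
    (hdiag : ∀ i, ∃ θ ∈ Θ, A θ (r i) (c i) ≠ 0) :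
    ∀ᵐ θ, θ ∈ Θ → ((A θ).submatrix r c).det ≠ 0 := by
  classical
  induction hm : Fintype.card ι using Nat.strong_induction_on generalizing ι with
  | _ m ih =>
  by_cases hp : ∃ a b, ∃ θ ∈ Θ, ∃ θ' ∈ Θ, A θ (r a) (c b) ≠ A θ' (r a) (c b)
  swap
  · push Not at hp
    refine Filter.Eventually.of_forall fun θ hθ => hfix r c hr hc hp θ hθ fun i => ?_
    obtain ⟨θ', hθ', h⟩ := hdiag i
    rwa [hp i i θ hθ θ' hθ']
  obtain ⟨a, b, hab⟩ := hp
  rcases exists_injective_or_exists_closed (fun i j => ∃ θ ∈ Θ, A θ (r i) (c j) ≠ 0) hdiag a b with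
    ⟨f, hf, hfb⟩ | ⟨S, hbS, haS, hS⟩
  · have hminor := ih (Fintype.card {i // i ≠ a})
      (hm ▸ Fintype.card_subtype_lt (x := a) (by simp)) (r ∘ Subtype.val) (c ∘ f)
      (hr.comp Subtype.val_injective) (hc.comp hf) (fun i => (hfb i).2) rfl
    let B : (Fin n → ℝ) → Matrix ι ι (RatFunc ℝ) := fun θ => (A θ).submatrix r c
    let C : (Fin n → ℝ) → Matrix ι ι (RatFunc ℝ) := fun θ => (B θ).updateRow a (Pi.single b 1)
    let D : (Fin n → ℝ) → Matrix ι ι (RatFunc ℝ) :=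
      fun θ => (B θ).updateRow a (Function.update (B θ a) b 0)
    have hC : ∀ i j, (fun θ => C θ i j) ∈ measurableFamilies Θ := by
      intro i j
      by_cases hi : i = a
      · subst hi
        simpa [C] using const_mem_measurableFamilies Θ _
      · simpa [C, B, Matrix.updateRow_ne hi] using hA _ _
    have hinv : ∀ θ ∈ Θ, ∀ θ' ∈ Θ, (∀ l ∉ block (r a) (c b), θ l = θ' l) →
        ∀ i j, (i, j) ≠ (a, b) → B θ i j = B θ' i j := by
      intro θ hθ θ' hθ' h i j hij
      refine hblock _ _ θ hθ θ' hθ' fun l hl => h l ?_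
      refine Set.disjoint_left.1 (hdisj _ _ _ _ fun hij' => hij ?_) hl
      rw [Prod.mk.injEq] at hij' ⊢
      exact ⟨hr hij'.1, hc hij'.2⟩
    have hCinv : ∀ θ ∈ Θ, ∀ θ' ∈ Θ, (∀ l ∉ block (r a) (c b), θ l = θ' l) → C θ = C θ' := by
      intro θ hθ θ' hθ' h
      ext i j : 2
      by_cases hi : i = a
      · subst hi; simp [C]
      · simpa [C, Matrix.updateRow_ne hi] using hinv θ hθ θ' hθ' h i j (by simp [hi])
    have hDinv : ∀ θ ∈ Θ, ∀ θ' ∈ Θ, (∀ l ∉ block (r a) (c b), θ l = θ' l) → D θ = D θ' := by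
      intro θ hθ θ' hθ' h
      ext i j : 2
      by_cases hi : i = a
      · subst hi
        by_cases hj : j = b
        · subst hj; simp [D]
        · simpa [D, hj] using hinv θ hθ θ' hθ' h i j (by simp [hj])
      · simpa [D, Matrix.updateRow_ne hi] using hinv θ hθ θ' hθ' h i j (by simp [hi])
    -- The exceptional set where the determinant vanishes but the cofactor does not. There the entry
    -- equals `-det D / det C`, which is unaffected by its own block of parameters.
    let E : Set (Fin n → ℝ) := {θ ∈ Θ | (B θ).det = 0} \ {θ ∈ Θ | (C θ).det = 0}
    have hval : ∀ θ ∈ E, A θ (r a) (c b) = -(D θ).det / (C θ).det := by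
      rintro θ ⟨⟨hθ, h0⟩, h1⟩
      have h1 : (C θ).det ≠ 0 := fun h => h1 ⟨hθ, h⟩
      rw [det_eq_mul_add_of_row (B θ) a b] at h0
      rw [eq_div_iff h1]
      exact eq_neg_of_add_eq_zero_left h0
    have hE : volume E = 0 := by
      refine volume_null_of_const_on_slices (MeasurableSet.diff
        (measurableSet_eq_zero_of_mem_measurableFamilies hΘ
          (det_mem_measurableFamilies fun i j => hA _ _))
        (measurableSet_eq_zero_of_mem_measurableFamilies hΘ (det_mem_measurableFamilies hC)))
        (block (r a) (c b)) (fun θ => A θ (r a) (c b))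
        (fun θ hθ θ' hθ' => hblock _ _ θ hθ.1.1 θ' hθ'.1.1) (fun θ hθ θ' hθ' h => ?_)
        fun v => measure_mono_null ?_ (hgen _ _ hab v)
      swap
      · exact fun θ hθ => ⟨hθ.1.1.1, hθ.2⟩
      rw [hval θ hθ, hval θ' hθ', hCinv θ hθ.1.1 θ' hθ'.1.1 h, hDinv θ hθ.1.1 θ' hθ'.1.1 h]
    filter_upwards [hminor, measure_eq_zero_iff_ae_notMem.1 hE] with θ hθ hθE hΘ h0
    refine hθE ⟨⟨hΘ, h0⟩, fun h => ?_⟩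
    exact det_updateRow_single_ne_zero (B θ) a b f hf (fun i => (hfb i).1) (hθ hΘ) h.2
  -- The matrix is block triangular with respect to `S`. Both diagonal blocks are smaller, as `b ∈
  -- S` and `a ∉ S`, and each inherits the diagonal matching.
  · have h1 := ih (Fintype.card {i // i ∉ S})
      (hm ▸ Fintype.card_subtype_lt (x := b) (by simpa using hbS)) (r ∘ Subtype.val)
      (c ∘ Subtype.val) (hr.comp Subtype.val_injective) (hc.comp Subtype.val_injective)
      (fun i => hdiag i.1) rfl
    have h2 := ih (Fintype.card {i // ¬ i ∉ S})
      (hm ▸ Fintype.card_subtype_lt (x := a) (by simpa using haS)) (r ∘ Subtype.val)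
      (c ∘ Subtype.val) (hr.comp Subtype.val_injective) (hc.comp Subtype.val_injective)
      (fun i => hdiag i.1) rfl
    filter_upwards [h1, h2] with θ hθ1 hθ2 hθ
    rw [Matrix.twoBlockTriangular_det _ (· ∉ S) fun i hi j hj => ?_]
    · exact mul_ne_zero (hθ1 hθ) (hθ2 hθ)
    · by_contra h
      exact hj (hS i (not_not.1 hi) j ⟨θ, hθ, h⟩)

/-! ### Evaluation of stable transfer functions -/

theorem Stable.add {f g : RatFunc ℝ} (hf : Stable f) (hg : Stable g) : Stable (f + g) := by
  intro z hz
  obtain ⟨q, hq⟩ := RatFunc.denom_add_dvd f g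
  have := congrArg (Polynomial.aeval z) hq
  rw [map_mul, map_mul, hz, zero_mul, mul_eq_zero] at this
  exact this.elim (hf z) (hg z)

theorem Stable.mul {f g : RatFunc ℝ} (hf : Stable f) (hg : Stable g) : Stable (f * g) := by
  intro z hz
  obtain ⟨q, hq⟩ := RatFunc.denom_mul_dvd f g
  have := congrArg (Polynomial.aeval z) hq
  rw [map_mul, map_mul, hz, zero_mul, mul_eq_zero] at this
  exact this.elim (hf z) (hg z)

theorem stable_algebraMap (q : Polynomial ℝ) :
    Stable (algebraMap (Polynomial ℝ) (RatFunc ℝ) q) := by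
  intro z hz
  simp at hz

/-- The stable transfer functions. -/
def stableSubring : Subring (RatFunc ℝ) where
  carrier := {f | Stable f}
  zero_mem' := by simpa using stable_algebraMap 0
  one_mem' := by simpa using stable_algebraMap 1
  add_mem' := Stable.add
  mul_mem' := Stable.mul
  neg_mem' := fun {f} hf => by simpa using (stable_algebraMap (-1)).mul hf

/-- Evaluation of stable transfer functions on or outside the unit circle. -/
def evalStable (z : ℂ) (hz : 1 ≤ ‖z‖) : stableSubring →+* ℂ where
  toFun f := RatFunc.eval (algebraMap ℝ ℂ) z f.1
  map_zero' := RatFunc.eval_zero _ _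
  map_one' := RatFunc.eval_one _ _
  map_add' f g := RatFunc.eval_add _ _ (fun h => (f.2 z h).not_ge hz) fun h => (g.2 z h).not_ge hz
  map_mul' f g := RatFunc.eval_mul _ _ (fun h => (f.2 z h).not_ge hz) fun h => (g.2 z h).not_ge hz

/-- Evaluation of rational functions respects sums and products only away from poles. Lifting to the
stable subring makes it a ring homomorphism, which preserves the identity `N * X = 1`. -/
theorem exists_leftInv_map_eval {l p : Type*} [Fintype l] [Fintype p] [DecidableEq p]
    (N : Matrix p l (RatFunc ℝ)) (X : Matrix l p (RatFunc ℝ)) (hN : ∀ k j, Stable (N k j))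
    (hX : ∀ j k, Stable (X j k)) (h : N * X = 1) (z : ℂ) (hz : 1 ≤ ‖z‖) :
    ∃ Y : Matrix p l ℂ, Y * X.map (RatFunc.eval (algebraMap ℝ ℂ) z) = 1 := by
  let N' : Matrix p l stableSubring := fun k j => ⟨N k j, hN k j⟩
  let X' : Matrix l p stableSubring := fun j k => ⟨X j k, hX j k⟩
  have h' : N' * X' = 1 := by
    apply Matrix.map_injective (f := stableSubring.subtype) Subtype.val_injective
    beta_reduce
    rw [Matrix.map_mul, Matrix.map_one _ (map_zero _) (map_one _)]
    exact h
  refine ⟨N'.map (evalStable z hz), ?_⟩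
  have := congrArg (fun Q => Matrix.map Q (evalStable z hz)) h'
  rw [Matrix.map_mul, Matrix.map_one _ (map_zero _) (map_one _)] at this
  exact this

theorem stable_matrix_mul {l m n : Type*} [Fintype m] {X : Matrix l m (RatFunc ℝ)}
    {Y : Matrix m n (RatFunc ℝ)} (hX : ∀ i j, Stable (X i j)) (hY : ∀ i j, Stable (Y i j))
    (i : l) (j : n) : Stable ((X * Y) i j) :=
  sum_mem (S := stableSubring) fun k _ => mul_mem (hX i k) (hY k j)

namespace ModelSet

variable {L K p n : ℕ} (M : ModelSet L K p n)

/-- The noise transfer matrix `(1 - G)⁻¹ * H` has the stable left inverse `N * (1 - G)`. Multiplying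
the spectrum by its value and the conjugate transpose isolates `Λ`; the single frequency `ω = 0`
suffices. -/
theorem covariance_eq_of_noiseSpectrum_eq {θ₀ θ₁ : Fin n → ℝ} (h₀ : θ₀ ∈ M.Θ)
    (hG : M.G θ₀ = M.G θ₁) (hH : M.H θ₀ = M.H θ₁)
    (h : M.noiseSpectrum θ₀ = M.noiseSpectrum θ₁) : M.Λ θ₀ = M.Λ θ₁ := by
  have hM := M.isModel θ₀ h₀
  obtain ⟨N, hN, hNH⟩ := hM.H_leftInv
  have hone : ∀ i j, Stable ((1 - M.G θ₀) i j) := fun i j => by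
    rw [Matrix.sub_apply, Matrix.one_apply]
    refine sub_mem (H := stableSubring) ?_ (hM.G_stable i j)
    split_ifs
    · exact one_mem stableSubring
    · exact zero_mem stableSubring
  obtain ⟨Y, hY⟩ := exists_leftInv_map_eval (N * (1 - M.G θ₀)) ((1 - M.G θ₀)⁻¹ * M.H θ₀)
    (stable_matrix_mul hN hone) (stable_matrix_mul hM.wellPosed_stable hM.H_stable)
    (by rw [Matrix.mul_assoc, Matrix.mul_nonsing_inv_cancel_left _ _ hM.wellPosed_unit, hNH])
    (Complex.exp (Complex.I * ((0 : ℝ) : ℂ))) (by simp)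
  have hres : M.noiseResponse θ₁ 0 = M.noiseResponse θ₀ 0 := by
    rw [noiseResponse, noiseResponse, hG, hH]
  change Y * M.noiseResponse θ₀ 0 = 1 at hY
  have hY' : (M.noiseResponse θ₀ 0).conjTranspose * Y.conjTranspose = 1 := by
    rw [← Matrix.conjTranspose_mul, hY, Matrix.conjTranspose_one]
  have hcancel : ∀ Q : Matrix (Fin p) (Fin p) ℂ,
      Y * (M.noiseResponse θ₀ 0 * Q * (M.noiseResponse θ₀ 0).conjTranspose) * Y.conjTranspose
        = Q := fun Q => by
    rw [Matrix.mul_assoc (M.noiseResponse θ₀ 0), ← Matrix.mul_assoc Y, hY, Matrix.one_mul,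
      Matrix.mul_assoc, hY', Matrix.mul_one]
  have h0 := congrFun h 0
  rw [noiseSpectrum, noiseSpectrum, hres] at h0
  have h1 := congrArg (fun Q => Y * Q * Y.conjTranspose) h0
  simp only [hcancel] at h1
  exact Matrix.map_injective (algebraMap ℝ ℂ).injective h1

/-! ### The matrix `[G - I  H  R]` -/

/-- The column of `[G - I  H  R]` that belongs to a vertex of the extended graph. -/
def vertexCol : Vertex L p → Fin L ⊕ Signal p K := Sum.map id Sum.inl

/-- The column of `[G - I  H  R]` that belongs to an external signal. -/
def signalCol : Signal p K → Fin L ⊕ Signal p K := Sum.inr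

theorem fullMatrix_inl (θ : Fin n → ℝ) (j i : Fin L) :
    M.fullMatrix θ j (Sum.inl i) = M.G θ j i - (1 : Matrix (Fin L) (Fin L) (RatFunc ℝ)) j i := rfl

theorem fullMatrix_mem_measurableFamilies (hmeas : M.MeasurablyParametrized) (j : Fin L)
    (c : Fin L ⊕ Signal p K) : (fun θ => M.fullMatrix θ j c) ∈ measurableFamilies M.Θ := by
  rcases c with i | k | k
  · exact sub_mem (hmeas.entry_eq j (Sum.inl i)) (const_mem_measurableFamilies _ _)
  · exact hmeas.entry_eq j (Sum.inr k)
  · exact const_mem_measurableFamilies _ _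

theorem volume_fullMatrix_eq (hgen : M.GenuinelyParametrized) (j : Fin L)
    (c : Fin L ⊕ Signal p K)
    (h : ∃ θ ∈ M.Θ, ∃ θ' ∈ M.Θ, M.fullMatrix θ j c ≠ M.fullMatrix θ' j c) (a : RatFunc ℝ) :
    volume {θ ∈ M.Θ | M.fullMatrix θ j c = a} = 0 := by
  obtain ⟨θ, hθ, θ', hθ', h⟩ := h
  rcases c with i | k | k
  · simp only [fullMatrix_inl, sub_eq_iff_eq_add]
    refine hgen j (Sum.inl i) ⟨θ, hθ, θ', hθ', fun h' => h ?_⟩ _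
    rw [fullMatrix_inl, fullMatrix_inl]
    exact congrArg (· - _) h'
  · exact hgen j (Sum.inr k) ⟨θ, hθ, θ', hθ', h⟩ a
  · exact absurd rfl h

theorem det_submatrix_fullMatrix_ne_zero_of_fixed (hrank : M.FixedFullStructuralRank)
    {ι : Type} [Fintype ι] [DecidableEq ι] (r : ι → Fin L) (c : ι → Fin L ⊕ Signal p K)
    (hr : Function.Injective r) (hc : Function.Injective c)
    (hfix : ∀ i j, ∀ θ ∈ M.Θ, ∀ θ' ∈ M.Θ,
      M.fullMatrix θ (r i) (c j) = M.fullMatrix θ' (r i) (c j))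
    (θ : Fin n → ℝ) (hθ : θ ∈ M.Θ) (hdiag : ∀ i, M.fullMatrix θ (r i) (c i) ≠ 0) :
    ((M.fullMatrix θ).submatrix r c).det ≠ 0 := by
  let er : ι ≃ (Finset.univ.image r : Finset (Fin L)) :=
    Equiv.ofBijective (fun i => ⟨r i, Finset.mem_image_of_mem _ (Finset.mem_univ _)⟩)
      ⟨fun i j h => hr (congrArg Subtype.val h), fun ⟨x, hx⟩ => by simpa using hx⟩
  let ec : ι ≃ (Finset.univ.image c : Finset (Fin L ⊕ Signal p K)) :=
    Equiv.ofBijective (fun i => ⟨c i, Finset.mem_image_of_mem _ (Finset.mem_univ _)⟩)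
      ⟨fun i j h => hc (congrArg Subtype.val h), fun ⟨x, hx⟩ => by simpa using hx⟩
  refine det_ne_zero_of_rank_eq_structuralRank _ er ec hdiag (hrank (Finset.univ.image r)
    (Finset.univ.image c) (fun i hi j hj => ?_) θ hθ)
  obtain ⟨i, -, rfl⟩ := Finset.mem_image.1 hi
  obtain ⟨j, -, rfl⟩ := Finset.mem_image.1 hj
  exact hfix i j

/-- A square submatrix of `[G - I  H  R]` with a perfect matching is generically nonsingular. -/
theorem ae_det_submatrix_fullMatrix_ne_zero (hmeas : M.MeasurablyParametrized)
    (hgen : M.GenuinelyParametrized) (hind : M.IndependentlyParametrized)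
    (hrank : M.FixedFullStructuralRank) {ι : Type} [Fintype ι] [DecidableEq ι] (r : ι → Fin L)
    (c : ι → Fin L ⊕ Signal p K) (hr : Function.Injective r) (hc : Function.Injective c)
    (hdiag : ∀ i, ∃ θ ∈ M.Θ, M.fullMatrix θ (r i) (c i) ≠ 0) :
    ∀ᵐ θ, θ ∈ M.Θ → ((M.fullMatrix θ).submatrix r c).det ≠ 0 := by
  obtain ⟨block, hdisj, hblock⟩ := hind
  refine ae_det_submatrix_ne_zero hmeas.measurableSet M.fullMatrix
    (M.fullMatrix_mem_measurableFamilies hmeas) (M.volume_fullMatrix_eq hgen)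
    (fun j => Sum.elim (fun i => block j (Sum.inl i))
      (Sum.elim (fun k => block j (Sum.inr k)) fun _ => ∅)) ?_ ?_
    (M.det_submatrix_fullMatrix_ne_zero_of_fixed hrank) r c hr hc hdiag
  · rintro i (j | j | j) i' (j' | j' | j') h <;>
      first
      | exact Set.disjoint_empty _
      | exact Set.empty_disjoint _
      | exact hdisj _ _ _ _ fun e => h (by cases e <;> rfl)
  · rintro i (j | j | j) θ hθ θ' hθ' h
    · rw [fullMatrix_inl, fullMatrix_inl]
      exact congrArg (· - _) (hblock i (Sum.inl j) θ hθ θ' hθ' h)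
    · exact hblock i (Sum.inr j) θ hθ θ' hθ' h
    · rfl

/-- If some nonsingular square submatrix of `[G - I  H  R]` avoids the columns in which the `j`-th
rows of two models with the same `T` differ, then these rows coincide. -/
theorem fullMatrix_row_eq {θ₀ θ₁ : Fin n → ℝ} (h₀ : θ₀ ∈ M.Θ) (h₁ : θ₁ ∈ M.Θ)
    (hT : M.T θ₀ = M.T θ₁) (j : Fin L) (f : Fin L → Fin L ⊕ Signal p K)
    (hf : ∀ i, M.fullMatrix θ₀ j (f i) = M.fullMatrix θ₁ j (f i))
    (hdet : ((M.fullMatrix θ₀).submatrix id f).det ≠ 0) (c : Fin L ⊕ Signal p K) :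
    M.fullMatrix θ₀ j c = M.fullMatrix θ₁ j c := by
  have hu₀ := (M.isModel θ₀ h₀).wellPosed_unit
  have hu₁ := (M.isModel θ₁ h₁).wellPosed_unit
  have hT₀ : (1 - M.G θ₀) * M.T θ₀ = Matrix.fromCols (M.H θ₀) M.R :=
    Matrix.mul_nonsing_inv_cancel_left _ _ hu₀
  have hT₁ : (1 - M.G θ₁) * M.T θ₀ = Matrix.fromCols (M.H θ₁) M.R := by
    rw [hT]
    exact Matrix.mul_nonsing_inv_cancel_left _ _ hu₁
  -- The choice for which `1 - Y = (1 - G θ₁) * (1 - G θ₀)⁻¹`, the left factor carrying the full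
  -- matrix at `θ₀` to that at `θ₁` when `T` agrees.
  let Y : Matrix (Fin L) (Fin L) (RatFunc ℝ) := (M.G θ₁ - M.G θ₀) * (1 - M.G θ₀)⁻¹
  have hY : Y * M.fullMatrix θ₀ = M.fullMatrix θ₀ - M.fullMatrix θ₁ := by
    have e1 : Y * (M.G θ₀ - 1) = M.G θ₀ - M.G θ₁ := by
      rw [← neg_sub 1, Matrix.mul_neg, Matrix.nonsing_inv_mul_cancel_right _ _ hu₀, neg_sub]
    have e2 : Y * Matrix.fromCols (M.H θ₀) M.R =
        Matrix.fromCols (M.H θ₀) M.R - Matrix.fromCols (M.H θ₁) M.R := by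
      rw [← hT₁, ← hT₀, ← Matrix.sub_mul, Matrix.mul_assoc,
        Matrix.nonsing_inv_mul_cancel_left _ _ hu₀, sub_sub_sub_cancel_left]
    rw [fullMatrix, Matrix.mul_fromCols, e1, e2]
    ext i (c | c)
    · simp [fullMatrix]
    · simp [fullMatrix]
  have hrow : ∀ c, Matrix.vecMul (Y j) (M.fullMatrix θ₀) c =
      M.fullMatrix θ₀ j c - M.fullMatrix θ₁ j c := fun c => congrFun (congrFun hY j) c
  have hy : Y j = 0 := by
    by_contra hne
    refine hdet (Matrix.exists_vecMul_eq_zero_iff.1 ⟨Y j, hne, ?_⟩)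
    ext i
    exact (hrow (f i)).trans (sub_eq_zero.2 (hf i))
  rw [← sub_eq_zero, ← hrow c, hy, Matrix.zero_vecMul, Pi.zero_apply]

end ModelSet
/-! ### Perfect matchings from an edge-disjoint covering by multi-rooted graphs -/

/-- A path that ends in `Q` starts there or enters it along some edge. -/
theorem exists_rel_of_reflTransGen {V : Type*} {r : V → V → Prop} {a b : V}
    (h : Relation.ReflTransGen r a b) (Q : Set V) (hb : b ∈ Q) :
    a ∈ Q ∨ ∃ x y, x ∉ Q ∧ y ∈ Q ∧ r x y := by
  induction h using Relation.ReflTransGen.head_induction_on with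
  | refl => exact Or.inl hb
  | @head a c hac _ ih =>
    rcases ih with hc | h
    · by_cases ha : a ∈ Q
      · exact Or.inl ha
      · exact Or.inr ⟨a, c, ha, hc, hac⟩
    · exact Or.inr h

namespace ModelSet

variable {L K p n : ℕ} (M : ModelSet L K p n)

theorem vertexCol_injective : Function.Injective (vertexCol : Vertex L p → Fin L ⊕ Signal p K) :=
  Function.injective_id.sumMap Sum.inl_injective

theorem fullMatrix_vertexCol_ne_zero {θ : Fin n → ℝ} {j : Fin L} {v : Vertex L p}
    (hv : v ≠ Sum.inl j) (h : M.entry θ j v ≠ 0) : M.fullMatrix θ j (vertexCol v) ≠ 0 := by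
  rcases v with i | k
  · have hij : j ≠ i := fun h => hv (congrArg Sum.inl h.symm)
    change M.fullMatrix θ j (Sum.inl i) ≠ 0
    rw [fullMatrix_inl, Matrix.one_apply_ne hij, sub_zero]
    exact h
  · exact h

theorem fullMatrix_signalCol_ne_zero (hΘ : M.Θ.Nonempty) {j : Fin L} {s : Signal p K}
    (h : M.Excites s (Sum.inl j)) : ∃ θ ∈ M.Θ, M.fullMatrix θ j (signalCol s) ≠ 0 := by
  rcases s with k | k
  · exact h
  · exact ⟨hΘ.some, hΘ.some_mem, h⟩

theorem fullMatrix_diag_ne_zero {θ : Fin n → ℝ} (hθ : θ ∈ M.Θ) (j : Fin L) :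
    M.fullMatrix θ j (Sum.inl j) ≠ 0 := by
  rw [fullMatrix_inl, (M.isModel θ hθ).G_diag, Matrix.one_apply_eq]
  simp

/-- The column `c` of `[G - I  H  R]` belongs to the source vertex of an edge of `S` or to the
external signal `s`. -/
def Serves (S : SubDigraph (Vertex L p)) (s : Signal p K) (c : Fin L ⊕ Signal p K) : Prop :=
  (∃ x y, c = vertexCol x ∧ S.Adj x y) ∨ c = signalCol s

variable {m : ℕ} {S : Fin m → SubDigraph (Vertex L p)} {τ : Fin m → Vertex L p}
  {σ : Fin m → Signal p K}

/-- All outgoing edges of a vertex belong to one graph of the covering, so a vertex is the source of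
edges in at most one SIMUG. -/
theorem eq_of_adj_of_adj (hS : M.IsEdgeDisjointSIMUGCovering S) {k k' : Fin m}
    {x y y' : Vertex L p} (h : (S k).Adj x y) (h' : (S k').Adj x y') : k = k' := by
  by_contra hne
  obtain ⟨hd, ho⟩ := hS.2.1 k k' hne
  rcases ho x (Or.inl ((S k).left_mem h)) with h1 | h1
  · exact hd _ _ ⟨h1 _ (Or.inr h'), h'⟩
  · exact hd _ _ ⟨h, h1 _ (Or.inl h)⟩

/-- A noise source that is the source vertex of an edge of a SIMUG is its only root. -/
theorem signal_eq_of_adj (hS : M.IsEdgeDisjointSIMUGCovering S)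
    (hτ : ∀ k, τ k ∈ (S k).roots ∧ M.Excites (σ k) (τ k)) {k : Fin m} {l : Fin p}
    {y : Vertex L p} (h : (S k).Adj (Sum.inr l) y) : σ k = Sum.inl l := by
  obtain ⟨⟨-, hroot⟩, hex⟩ := hτ k
  have hτl : τ k = Sum.inr l := by
    rcases exists_rel_of_reflTransGen (hroot _ ((S k).left_mem h)) {Sum.inr l} rfl with
      h' | ⟨x, z, -, rfl, hxz⟩
    · exact h'
    · exact absurd ((hS.2.2 _ _).2 ⟨k, hxz⟩) id
  rw [hτl] at hex
  cases hσ : σ k with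
  | inl i => rw [hσ] at hex; exact congrArg Sum.inl (Eq.symm hex)
  | inr i => rw [hσ] at hex; exact hex.elim

/-- The delicate case is the column of a noise source, which is both a vertex column and a signal
column. If the source has an outgoing edge in a SIMUG, it is the signal assigned to that SIMUG, and
injectivity of `σ` applies. -/
theorem eq_of_serves_of_serves (hS : M.IsEdgeDisjointSIMUGCovering S)
    (hσ : Function.Injective σ) (hτ : ∀ k, τ k ∈ (S k).roots ∧ M.Excites (σ k) (τ k))
    {k k' : Fin m} {c : Fin L ⊕ Signal p K} (h : Serves (S k) (σ k) c)
    (h' : Serves (S k') (σ k') c) : k = k' := by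
  have aux : ∀ {k k' : Fin m} {x y : Vertex L p}, (S k).Adj x y →
      vertexCol x = signalCol (L := L) (σ k') → k = k' := by
    rintro k k' (x | l) y hxy hc
    · cases hc
    · exact hσ ((M.signal_eq_of_adj hS hτ hxy).trans (Sum.inr_injective hc))
  rcases h with ⟨x, y, rfl, hxy⟩ | rfl <;> rcases h' with ⟨x', y', hc, hxy'⟩ | hc
  · rw [← vertexCol_injective hc] at hxy'
    exact M.eq_of_adj_of_adj hS hxy hxy'
  · exact aux hxy hc
  · exact (aux hxy' hc.symm).symm
  · exact hσ (Sum.inr_injective hc)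

/-- A set `s` of nodes meets a nonzero entry outside its own columns, in a column that serves the
SIMUG `S k`, if it contains a vertex of `S k`. -/
theorem exists_serves (hS : M.IsEdgeDisjointSIMUGCovering S) (hΘ : M.Θ.Nonempty)
    (hτ : ∀ k, τ k ∈ (S k).roots ∧ M.Excites (σ k) (τ k)) (s : Finset (Fin L)) {i : Fin L}
    (hi : i ∈ s) {k : Fin m} (hk : Sum.inl i ∈ (S k).verts) :
    ∃ c, Serves (S k) (σ k) c ∧ (∀ i' ∈ s, c ≠ Sum.inl i') ∧
      ∃ i' ∈ s, ∃ θ ∈ M.Θ, M.fullMatrix θ i' c ≠ 0 := by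
  obtain ⟨⟨-, hroot⟩, hex⟩ := hτ k
  rcases exists_rel_of_reflTransGen (hroot _ hk) (Sum.inl '' (s : Set (Fin L))) ⟨i, hi, rfl⟩ with
    ⟨i', hi', hτi⟩ | ⟨x, _, hx, ⟨i', hi', rfl⟩, hxy⟩
  · rw [← hτi] at hex
    exact ⟨signalCol (σ k), Or.inr rfl, fun _ _ => Sum.inr_ne_inl, i', hi',
      M.fullMatrix_signalCol_ne_zero hΘ hex⟩
  · obtain ⟨θ, hθ, hne⟩ := (hS.2.2 _ _).2 ⟨k, hxy⟩
    have hxs : ∀ i ∈ s, x ≠ Sum.inl i := fun i hi h => hx ⟨i, hi, h.symm⟩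
    exact ⟨vertexCol x, Or.inl ⟨x, _, rfl, hxy⟩,
      fun i hi h => hxs i hi (vertexCol_injective (h.trans rfl)), i', hi', θ, hθ,
      M.fullMatrix_vertexCol_ne_zero (hxs i' hi') hne⟩

/-- All rows of `[G - I  H  R]` can be matched to columns other than those of the parametrized
in-neighbours of a given node. -/
theorem exists_matching (hS : M.IsEdgeDisjointSIMUGCovering S) (hΘ : M.Θ.Nonempty)
    (hσ : Function.Injective σ) (hτ : ∀ k, τ k ∈ (S k).roots ∧ M.Excites (σ k) (τ k))
    (j : Fin L) : ∃ f : Fin L → Fin L ⊕ Signal p K, Function.Injective f ∧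
      ∀ i, (∃ θ ∈ M.Θ, M.fullMatrix θ i (f i) ≠ 0) ∧
        ∀ v, M.Parametrized j v → f i ≠ vertexCol v := by
  classical
  have hP : ∀ v, M.Parametrized j v → ∃ k, (S k).Adj v (Sum.inl j) := by
    rintro v ⟨θ, hθ, θ', hθ', hne⟩
    refine (hS.2.2 _ _).1 ?_
    by_cases h0 : M.entry θ j v = 0
    · exact ⟨θ', hθ', fun h => hne (h0.trans h.symm)⟩
    · exact ⟨θ, hθ, h0⟩
  choose κ hκ using hP
  have hκinj : ∀ v hv v' hv', κ v hv = κ v' hv' → v = v' := by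
    intro v hv v' hv' h
    have hv2 := hκ v' hv'
    rw [← h] at hv2
    exact Set.encard_le_one_iff.1 ((hS.1 (κ v hv)).2.2 _ ((S _).right_mem (hκ v hv))) v v'
      ⟨hκ v hv, hv⟩ ⟨hv2, hv'⟩
  have hserves : ∀ v hv, Serves (S (κ v hv)) (σ (κ v hv)) (vertexCol v) := fun v hv =>
    Or.inl ⟨v, _, rfl, hκ v hv⟩
  let t : Fin L → Finset (Fin L ⊕ Signal p K) := fun i =>
    {c | (∃ θ ∈ M.Θ, M.fullMatrix θ i c ≠ 0) ∧ ∀ v, M.Parametrized j v → c ≠ vertexCol v}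
  have ht : ∀ i c, c ∈ t i ↔ (∃ θ ∈ M.Θ, M.fullMatrix θ i c ≠ 0) ∧
      ∀ v, M.Parametrized j v → c ≠ vertexCol v := fun i c => by simp [t]
  have hall : ∀ s : Finset (Fin L), s.card ≤ (s.biUnion t).card := by
    intro s
    have hextra : ∀ i : Fin L, ∀ h : M.Parametrized j (Sum.inl i), ∃ c, i ∈ s →
        Serves (S (κ _ h)) (σ (κ _ h)) c ∧ (∀ i' ∈ s, c ≠ Sum.inl i') ∧
          ∃ i' ∈ s, ∃ θ ∈ M.Θ, M.fullMatrix θ i' c ≠ 0 := fun i h => by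
      by_cases hi : i ∈ s
      · obtain ⟨c, hc⟩ := M.exists_serves hS hΘ hτ s hi ((S _).left_mem (hκ _ h))
        exact ⟨c, fun _ => hc⟩
      · exact ⟨Sum.inl i, fun h => absurd h hi⟩
    choose g hg using hextra
    refine Finset.card_le_card_of_injOn
      (fun i => if h : M.Parametrized j (Sum.inl i) then g i h else Sum.inl i)
      (fun i hi => ?_) fun i hi i' hi' h => ?_
    · rw [Finset.mem_coe, Finset.mem_biUnion]
      by_cases h : M.Parametrized j (Sum.inl i)
      · obtain ⟨hc, hcs, i', hi', hne⟩ := hg i h hi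
        refine ⟨i', hi', ?_⟩
        simp only [dif_pos h, ht]
        -- A substitute column that were forbidden would belong to an in-neighbour in the same
        -- SIMUG, hence to `w_i` itself; but it lies outside the columns of `s`.
        refine ⟨hne, fun v hv hcv => hcs i hi (hcv.trans ?_)⟩
        have := M.eq_of_serves_of_serves hS hσ hτ hc (hcv ▸ hserves v hv)
        rw [← hκinj _ h _ hv this]
        rfl
      · refine ⟨i, hi, ?_⟩
        simp only [dif_neg h, ht]
        exact ⟨⟨_, hΘ.some_mem, M.fullMatrix_diag_ne_zero hΘ.some_mem i⟩, fun v hv hiv =>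
          h ((vertexCol_injective (K := K) (a₁ := Sum.inl i) (a₂ := v) hiv) ▸ hv)⟩
    · by_cases hp : M.Parametrized j (Sum.inl i) <;> by_cases hp' : M.Parametrized j (Sum.inl i')
      · simp only [dif_pos hp, dif_pos hp'] at h
        exact Sum.inl_injective (hκinj _ hp _ hp' (M.eq_of_serves_of_serves hS hσ hτ
          (hg i hp hi).1 (h ▸ (hg i' hp' hi').1)))
      · simp only [dif_pos hp, dif_neg hp'] at h
        exact absurd h ((hg i hp hi).2.1 i' hi')
      · simp only [dif_neg hp, dif_pos hp'] at h
        exact absurd h.symm ((hg i' hp' hi').2.1 i hi)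
      · simp only [dif_neg hp, dif_neg hp'] at h
        exact Sum.inl_injective h
  obtain ⟨f, hf, hft⟩ := (Finset.all_card_le_biUnion_card_iff_exists_injective t).1 hall
  exact ⟨f, hf, fun i => (ht _ _).1 (hft i)⟩

theorem fullMatrix_eq_of_not_parametrized {θ θ' : Fin n → ℝ} (hθ : θ ∈ M.Θ) (hθ' : θ' ∈ M.Θ)
    (j : Fin L) (c : Fin L ⊕ Signal p K) (h : ∀ v, M.Parametrized j v → c ≠ vertexCol v) :
    M.fullMatrix θ j c = M.fullMatrix θ' j c := by
  have aux : ∀ v, c = vertexCol v → M.entry θ j v = M.entry θ' j v := fun v hv => by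
    by_contra hne
    exact h v ⟨θ, hθ, θ', hθ', hne⟩ hv
  rcases c with i | k | k
  · rw [fullMatrix_inl, fullMatrix_inl]
    exact congrArg (· - _) (aux (Sum.inl i) rfl)
  · exact aux (Sum.inr k) rfl
  · rfl

end ModelSet

end DynNet

end

/-- A model set whose entries are measurably, genuinely and independently parametrized and whose
fixed submatrices have full structural rank is generically identifiable from `(r, w)` if the edges
of its extended graph have an edge-disjoint SIMUG covering in which each SIMUG has a root that is
excited by an external signal of its own. -/
theorem theorem1 {L K p n : ℕ} (M : DynNet.ModelSet L K p n)
    (hmeas : M.MeasurablyParametrized) (hgen : M.GenuinelyParametrized)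
    (hind : M.IndependentlyParametrized) (hrank : M.FixedFullStructuralRank)
    (hcover : ∃ (m : ℕ) (S : Fin m → DynNet.SubDigraph (DynNet.Vertex L p)),
      M.IsEdgeDisjointSIMUGCovering S ∧
      ∃ (τ : Fin m → DynNet.Vertex L p) (σ : Fin m → DynNet.Signal p K),
        Function.Injective σ ∧ ∀ k, τ k ∈ (S k).roots ∧ M.Excites (σ k) (τ k)) :
    M.GenericallyIdentifiable := by
  obtain ⟨m, S, hS, τ, σ, hσ, hτ⟩ := hcover
  rcases M.Θ.eq_empty_or_nonempty with hΘ | hΘ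
  · exact Filter.Eventually.of_forall fun θ hθ => absurd (hΘ ▸ hθ) (Set.notMem_empty θ)
  choose f hf hfj using M.exists_matching hS hΘ hσ hτ
  have hdet := ae_all_iff.2 fun j => M.ae_det_submatrix_fullMatrix_ne_zero hmeas hgen hind hrank
    id (f j) Function.injective_id (hf j) fun i => (hfj j i).1
  filter_upwards [hdet] with θ₀ hdet h₀ θ₁ h₁ hT
  have hrow : ∀ j c, M.fullMatrix θ₀ j c = M.fullMatrix θ₁ j c := fun j =>
    M.fullMatrix_row_eq h₀ h₁ hT j (f j)
      (fun i => M.fullMatrix_eq_of_not_parametrized h₀ h₁ j _ (hfj j i).2) (hdet j h₀)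
  have hG : M.G θ₀ = M.G θ₁ := by
    ext j i : 2
    exact sub_left_injective (hrow j (Sum.inl i))
  have hH : M.H θ₀ = M.H θ₁ := by
    ext j k : 2
    exact hrow j (Sum.inr (Sum.inl k))
  exact ⟨hG, hH, M.covariance_eq_of_noiseSpectrum_eq h₀ hG hH⟩
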